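/- Let $V$ be a real normed space. Busemann's definition of volume assigns to each finite-dimensional normed space $W$, $\dim W=n$, the Lebesgue (translation-invariant) measure $\mu_W$ on $W$ for which the unit ball of $W$ has measure $\omega_n$, the volume of the Euclidean unit ball in $\mathbb{R}^n$. The induced $2$-volume density $\mu_2$ on $V$ assigns to a simple $2$-vector $v_1\wedge v_2\neq 0$ the measure $\mu_W(\{t_1v_1+t_2v_2 : 0\le t_1,t_2\le 1\})$, where $W\subset V$ is the plane spanned by $v_1,v_2$ with the induced norm, and $\mu_2(0)=0$. 1. The density $\mu_2$ is extendibly convex: there is a norm $N$ on the exterior power $\Lambda^2V$ such that $N(v_1\wedge v_2)=\mu_2(v_1\wedge v_2)$ for all $v_1,v_2\in V$. 2. If $V$ is finite-dimensional, flat $2$-discs are area-minimizing for Busemann area. More precisely, let $K\subset\mathbb{R}^2$ be a bounded measurable set (for instance a disc), let $f(x)=p+Ax$ with $p\in V$ and $A:\mathbb{R}^2\to V$ linear and injective, and let $S=\sum_i c_i\sigma_i$ be a Lipschitz $2$-chain in $V$, i.e. a finite sum with $c_i\in\mathbb{R}$ and Lipschitz maps $\sigma_i:\Delta\to V$, $\Delta=\{x\in\mathbb{R}^2: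 x_1,x_2\ge 0,\ x_1+x_2\le 1\}$. Suppose that $S$ has the same boundary as the flat region $f|_K$ in the sense of currents, i.e. $\sum_i c_i\int_\Delta\sigma_i^*d\eta=\int_K f^*d\eta$ for every smooth $1$-form $\eta$ on $V$. Then $$\int_K\mu_2(\partial_1f\wedge\partial_2f)\,dx\le\sum_i|c_i|\int_\Delta\mu_2(\partial_1\sigma_i\wedge\partial_2\sigma_i)\,dx .$$ -/

import Mathlib

open MeasureTheory Module
open scoped ENNReal ContDiff

noncomputable section

/-- The closed unit ball of a finite-dimensional normed space, as a compact set with non-empty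
interior. -/
def unitBallCompacts (W : Type*) [NormedAddCommGroup W] [NormedSpace ℝ W]
    [FiniteDimensional ℝ W] : TopologicalSpace.PositiveCompacts W where
  carrier := Metric.closedBall 0 1
  isCompact' := by
    have : ProperSpace W := FiniteDimensional.proper_real W
    exact isCompact_closedBall 0 1
  interior_nonempty' :=
    ⟨0, Metric.ball_subset_interior_closedBall (Metric.mem_ball_self one_pos)⟩

/-- The volume `ω n` of the Euclidean unit ball of dimension `n`. -/
def euclideanBallVolume (n : ℕ) : ℝ≥0∞ :=
  volume (Metric.closedBall (0 : EuclideanSpace ℝ (Fin n)) 1)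

/-- Busemann's definition of volume: on a normed space `W` of dimension `n` it is the Lebesgue
(translation-invariant) measure that gives the unit ball of `W` the measure `ω n`. -/
def busemannMeasure (W : Type*) [NormedAddCommGroup W] [NormedSpace ℝ W]
    [FiniteDimensional ℝ W] [MeasurableSpace W] [BorelSpace W] : Measure W :=
  euclideanBallVolume (finrank ℝ W) • Measure.addHaarMeasure (unitBallCompacts W)

open Classical in
/-- The `k`-volume density induced by Busemann's definition of volume, as a function of
`v 0, …, v (k - 1)`: the Busemann measure, in the span of the `v i` with the induced norm, of the
parallelepiped that they generate. It is `0` when the simple `k`-vector `v 0 ∧ … ∧ v (k - 1)`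
vanishes, i.e. when the `v i` are linearly dependent. -/
def busemannDensity {V : Type*} [NormedAddCommGroup V] [NormedSpace ℝ V] [MeasurableSpace V]
    [BorelSpace V] {k : ℕ} (v : Fin k → V) : ℝ :=
  haveI := FiniteDimensional.span_of_finite ℝ (Set.finite_range v)
  if LinearIndependent ℝ v then
    (busemannMeasure (Submodule.span ℝ (Set.range v))).real
      (parallelepiped fun i =>
        (⟨v i, Submodule.subset_span (Set.mem_range_self i)⟩ : Submodule.span ℝ (Set.range v)))
  else 0

/-- A `k`-volume density `μ`, given as a function of `k`-tuples of vectors, is extendibly convex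
if it is the restriction to the simple `k`-vectors `v 0 ∧ … ∧ v (k - 1)` of a norm on the `k`-th
exterior power. -/
def IsExtendiblyConvex {V : Type*} [AddCommGroup V] [Module ℝ V] {k : ℕ}
    (μ : (Fin k → V) → ℝ) : Prop :=
  ∃ N : Seminorm ℝ (⋀[ℝ]^k V), (∀ a, N a = 0 → a = 0) ∧
    ∀ v : Fin k → V, N (exteriorPower.ιMulti ℝ k v) = μ v

section Chains

variable {V : Type*} [NormedAddCommGroup V] [NormedSpace ℝ V] {k : ℕ}

/-- The partial derivatives of a map from `ℝ^k` to `V` at a point. -/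
def partials (f : (Fin k → ℝ) → V) (x : Fin k → ℝ) : Fin k → V :=
  fun i => fderiv ℝ f x (Pi.single i 1)

/-- The `μ`-area of the piece of surface parametrized by `f` on `K`. -/
def pieceArea (μ : (Fin k → V) → ℝ) (K : Set (Fin k → ℝ)) (f : (Fin k → ℝ) → V) : ℝ≥0∞ :=
  ∫⁻ x in K, ENNReal.ofReal (μ (partials f x))

/-- The integral of the differential `k`-form `θ` over the oriented piece of surface parametrized
by `f` on `K`. -/
def pieceIntegral (K : Set (Fin k → ℝ)) (f : (Fin k → ℝ) → V)
    (θ : V → V [⋀^Fin k]→L[ℝ] ℝ) : ℝ :=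
  ∫ x in K, θ (f x) (partials f x)

/-- The simplex with vertices `0` and the standard basis vectors in `ℝ^k`. -/
def cornerSimplex (k : ℕ) : Set (Fin k → ℝ) :=
  {x | (∀ i, 0 ≤ x i) ∧ ∑ i, x i ≤ 1}

/-- A singular Lipschitz `k`-simplex in `V`: a Lipschitz map from the simplex to `V`, extended
by `0`. (Its derivatives are only used almost everywhere, in the interior of the simplex.) -/
structure LipschitzSimplex (k : ℕ) (V : Type*) [NormedAddCommGroup V] where
  toFun : (Fin k → ℝ) → V
  lipschitz : ∃ C : NNReal, LipschitzOnWith C toFun (cornerSimplex k)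
  eq_zero : ∀ x, x ∉ cornerSimplex k → toFun x = 0

/-- Lipschitz `k`-chains with real coefficients. -/
abbrev LipschitzChain (k : ℕ) (V : Type*) [NormedAddCommGroup V] : Type _ :=
  LipschitzSimplex k V →₀ ℝ

/-- The `μ`-area of a Lipschitz chain. -/
def chainArea (μ : (Fin k → V) → ℝ) (S : LipschitzChain k V) : ℝ≥0∞ :=
  S.sum fun σ c => ENNReal.ofReal |c| * pieceArea μ (cornerSimplex k) σ.toFun

/-- The integral of a differential `k`-form over a Lipschitz chain. -/
def chainIntegral (S : LipschitzChain k V) (θ : V → V [⋀^Fin k]→L[ℝ] ℝ) : ℝ :=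
  S.sum fun σ c => c * pieceIntegral (cornerSimplex k) σ.toFun θ

end Chains

/-- The Lipschitz chain `S` and the oriented piece of surface parametrized by `f` on `K` have the
same boundary, in the sense of currents: the boundary of `T` is the functional that sends a smooth
form `η` to the integral of `dη` over `T`. -/
def HasSameBoundary {V : Type*} [NormedAddCommGroup V] [NormedSpace ℝ V] {n : ℕ}
    (S : LipschitzChain (n + 1) V) (K : Set (Fin (n + 1) → ℝ)) (f : (Fin (n + 1) → ℝ) → V) :
    Prop :=
  ∀ η : V → V [⋀^Fin n]→L[ℝ] ℝ, ContDiff ℝ ∞ η →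
    chainIntegral S (extDeriv η) = pieceIntegral K f (extDeriv η)

/-- Semi-ellipticity over `ℝ`: each flat region of dimension `n + 1` (the image of a bounded
measurable set, for instance of a disc, under an injective affine map `x ↦ p + A x`) has minimal
`μ`-area among all Lipschitz chains with real coefficients and the same boundary. -/
def IsSemiElliptic {V : Type*} [NormedAddCommGroup V] [NormedSpace ℝ V] (n : ℕ)
    (μ : (Fin (n + 1) → V) → ℝ) : Prop :=
  ∀ (p : V) (A : (Fin (n + 1) → ℝ) →ₗ[ℝ] V), Function.Injective A →
    ∀ K : Set (Fin (n + 1) → ℝ), MeasurableSet K → Bornology.IsBounded K →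
      ∀ S : LipschitzChain (n + 1) V, HasSameBoundary S K (fun x => p + A x) →
        pieceArea μ K (fun x => p + A x) ≤ chainArea μ S

end

/-! The Busemann density of `v ∧ w` is `π / A`, where `A` is the area of the unit disc of the plane
of `v` and `w` in the coordinates given by `v`, `w`. The point is that this quantity is a supremum
of functions that are visibly convex on the exterior square: for all finite families of functionals
`F i` on `V`, with `W = ∑ ‖F i‖`, the sum `∑ |F i ∧ F j (v, w)|` is at most `2 W ^ 2 / A`, and the
constant is sharp in each plane.

The inequality (`sum_abs_wedge_mul_radialArea_le`) is of Minkowski type. Replace the disc by an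
inscribed symmetric polygon of area `S`. Since `|det|` is a conditionally negative definite kernel
in the plane, comparing the `F i` with the rotated edges scaled by `t` gives `Q - 2 t M + t ^ 2 E ≤
0`, where `Q`, `M`, `E` are the sums of `|det|` over pairs functional–functional, functional–edge,
edge–edge. Convexity gives `M ≤ 2 W` and `E ≥ 2 S`, whence `Q S ≤ 2 W ^ 2`; then the polygon tends
to the disc. Near-equality comes from functionals constant on the edges of a fine polygon, extended
by Hahn–Banach (`exists_lt_sum_abs_wedge_mul_radialArea`).

Fixing the signs that occur at one pair `v` turns the sum into a 2-form dominated by the density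
everywhere and almost equal to it at `v` (`exists_calibration`). The supremum of the dominated
linear functionals is the required norm, and Stokes' theorem for these constant-coefficient forms
gives minimality. -/

/-! ### Conditionally negative definite kernels and variation of sequences. -/

/-- The kernel `|r i - r j|` on the line is conditionally negative definite. -/
theorem sum_mul_abs_sub_nonpos {ι : Type*} [Fintype ι] (y r : ι → ℝ) (hy : ∑ i, y i = 0) :
    ∑ i, ∑ j, y i * y j * |r i - r j| ≤ 0 := by
  classical
  -- `|r i - r j|` is the squared `L²` distance between indicators of half-lines.
  set h : ι → ℝ → ℝ := fun i u => if u ≤ r i then 1 else 0 with hh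
  have hind : ∀ i j, (fun u => (h i u - h j u) ^ 2) =
      (Set.uIoc (r i) (r j)).indicator (fun _ => (1 : ℝ)) := by
    intro i j
    funext u
    simp only [hh, Set.indicator, Set.mem_uIoc]
    split_ifs <;> first | (norm_num; done) | (exfalso; grind)
  have hfin : ∀ i j, volume (Set.uIoc (r i) (r j)) ≠ ⊤ := by
    intro i j
    rw [Real.volume_uIoc]
    exact ENNReal.ofReal_ne_top
  have hint : ∀ i j, Integrable (fun u => (h i u - h j u) ^ 2) := by
    intro i j
    rw [hind, integrable_indicator_iff measurableSet_uIoc]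
    exact integrableOn_const (hfin i j)
  have habs : ∀ i j, |r i - r j| = ∫ u, (h i u - h j u) ^ 2 := by
    intro i j
    rw [hind, integral_indicator_const _ measurableSet_uIoc, measureReal_def, Real.volume_uIoc,
      ENNReal.toReal_ofReal (abs_nonneg _), abs_sub_comm]
    simp
  have hsum : ∑ i, ∑ j, y i * y j * |r i - r j| =
      ∫ u, ∑ i, ∑ j, y i * y j * (h i u - h j u) ^ 2 := by
    rw [integral_finsetSum _ fun i _ => integrable_finsetSum _ fun j _ => (hint i j).const_mul _]
    refine Finset.sum_congr rfl fun i _ => ?_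
    rw [integral_finsetSum _ fun j _ => (hint i j).const_mul _]
    refine Finset.sum_congr rfl fun j _ => ?_
    rw [integral_const_mul, habs]
  rw [hsum]
  refine integral_nonpos fun u => ?_
  change _ ≤ (0 : ℝ)
  have : ∑ i, ∑ j, y i * y j * (h i u - h j u) ^ 2 = -2 * (∑ i, y i * h i u) ^ 2 := by
    have e : ∀ i j, y i * y j * (h i u - h j u) ^ 2 =
        (y i * h i u ^ 2) * y j + y i * (y j * h j u ^ 2)
          - 2 * ((y i * h i u) * (y j * h j u)) := by
      intro i j; ring
    simp only [e, Finset.sum_add_distrib, Finset.sum_sub_distrib, ← Finset.mul_sum,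
      ← Finset.sum_mul, hy]
    ring
  rw [this]
  nlinarith [sq_nonneg (∑ i, y i * h i u)]

/-- The kernel `|det (z i, z j)|` in the plane is conditionally negative definite. -/
theorem sum_mul_abs_det_nonpos {ι : Type*} [Fintype ι] (c s t : ι → ℝ)
    (hc : ∑ i, c i * |s i| = 0) :
    ∑ i, ∑ j, c i * c j * |s i * t j - t i * s j| ≤ 0 := by
  classical
  -- Away from `s = 0` the determinant is `|s i| |s j|` times a difference of slopes, which reduces
  -- to the line. Vectors with `s = 0` only add terms containing the factor `∑ c i * |s i| = 0`.
  set b : ι → ℝ := fun i => if s i = 0 then |t i| else 0 with hb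
  have key : ∀ i j, c i * c j * |s i * t j - t i * s j| =
      (c i * |s i|) * (c j * |s j|) * |t i / s i - t j / s j|
        + (c i * b i) * (c j * |s j|) + (c i * |s i|) * (c j * b j) := by
    intro i j
    have : |s i * t j - t i * s j| =
        |s i| * |s j| * |t i / s i - t j / s j| + b i * |s j| + |s i| * b j := by
      by_cases hi : s i = 0 <;> by_cases hj : s j = 0
      · simp [hb, hi, hj]
      · simp [hb, hi, hj, abs_mul]
      · simp [hb, hi, hj, abs_mul]
      · simp only [hb, hi, hj, if_false, zero_mul, mul_zero, add_zero]
        rw [← abs_mul, ← abs_mul, abs_sub_comm]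
        congr 1
        field_simp
    rw [this]; ring
  simp only [key, Finset.sum_add_distrib, ← Finset.mul_sum, ← Finset.sum_mul, hc]
  simpa using sum_mul_abs_sub_nonpos (fun i => c i * |s i|) (fun i => t i / s i) hc

theorem sum_range_add_of_periodic {g : ℕ → ℝ} {n : ℕ} (hg : ∀ k, g (k + n) = g k) (m : ℕ) :
    ∑ k ∈ Finset.range n, g (m + k) = ∑ k ∈ Finset.range n, g k := by
  induction m with
  | zero => simp
  | succ m ih =>
    have h1 := Finset.sum_range_succ (fun k => g (m + k)) n
    have h2 := Finset.sum_range_succ' (fun k => g (m + k)) n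
    have h3 : ∀ k, g (m + 1 + k) = g (m + (k + 1)) := fun k => by congr 1; ring
    simp only [h3]
    rw [hg m] at h1
    simp only [add_zero] at h2
    linarith

/-- The variation of an antiperiodic sequence over half of its period is at least twice each of
its values. -/
theorem two_mul_le_sum_abs_sub {F : ℕ → ℝ} {n : ℕ} (hF : ∀ k, F (k + n) = -F k) {k : ℕ}
    (hk : k ≤ n) : 2 * F k ≤ ∑ l ∈ Finset.range n, |F (l + 1) - F l| := by
  -- Descend from `F k` to both ends: as `F n = -F 0`, the two drops add up to `2 * F k`.
  have h1 : F k - F 0 ≤ ∑ l ∈ Finset.range k, |F (l + 1) - F l| := by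
    rw [← Finset.sum_range_sub]
    exact Finset.sum_le_sum fun l _ => le_abs_self _
  have h2 : F k - F n ≤ ∑ l ∈ Finset.Ico k n, |F (l + 1) - F l| := by
    have := Finset.sum_Ico_sub F hk
    calc F k - F n = ∑ l ∈ Finset.Ico k n, -(F (l + 1) - F l) := by
          rw [Finset.sum_neg_distrib, this]; ring
      _ ≤ _ := Finset.sum_le_sum fun l _ => neg_le_abs _
  have h3 := Finset.sum_range_add_sum_Ico (fun l => |F (l + 1) - F l|) hk
  have h4 := hF 0
  rw [zero_add] at h4
  linarith

/-! ### Inscribed polygons and the area inequality. -/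

/-- The points `x k • v + y k • w` are the successive vertices of a centrally symmetric polygon
with `2 * n` vertices, inscribed in the unit circle of the plane spanned by `v` and `w`. -/
structure IsInscribedPolygon {V : Type*} [NormedAddCommGroup V] [NormedSpace ℝ V] (v w : V)
    (n : ℕ) (x y : ℕ → ℝ) : Prop where
  norm_eq : ∀ k, ‖x k • v + y k • w‖ = 1
  x_add : ∀ k, x (k + n) = -x k
  y_add : ∀ k, y (k + n) = -y k
  det_pos : ∀ k l, k < l → l < k + n → 0 < x k * y l - y k * x l
  two_le : 2 ≤ n

/-- Twice the area of half of a centrally symmetric polygon. -/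
noncomputable def halfPolygonArea (n : ℕ) (x y : ℕ → ℝ) : ℝ :=
  ∑ k ∈ Finset.range n, (x k * y (k + 1) - y k * x (k + 1))

namespace IsInscribedPolygon

variable {V : Type*} [NormedAddCommGroup V] [NormedSpace ℝ V] {v w : V} {n : ℕ} {x y : ℕ → ℝ}

theorem det_succ_pos (h : IsInscribedPolygon v w n x y) (k : ℕ) :
    0 < x k * y (k + 1) - y k * x (k + 1) :=
  h.det_pos k (k + 1) (by omega) (by have := h.two_le; omega)

theorem halfPolygonArea_pos (h : IsInscribedPolygon v w n x y) : 0 < halfPolygonArea n x y :=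
  Finset.sum_pos (fun k _ => h.det_succ_pos k) (by have := h.two_le; simp; omega)

/-- Cramer's rule writes the middle vertex as a positive combination of the outer two; since all
three have norm one, the triangle inequality makes the coefficients add up to at least one. This is
the convexity of the polygon. -/
theorem det_le_add (h : IsInscribedPolygon v w n x y) {a b c : ℕ} (hab : a < b) (hbc : b < c)
    (hca : c < a + n) :
    x a * y c - y a * x c ≤ (x b * y c - y b * x c) + (x a * y b - y a * x b) := by
  have e : (x a * y c - y a * x c) • (x b • v + y b • w) =
      (x b * y c - y b * x c) • (x a • v + y a • w)
        + (x a * y b - y a * x b) • (x c • v + y c • w) := by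
    module
  have := congrArg norm e
  have h1 := norm_add_le ((x b * y c - y b * x c) • (x a • v + y a • w))
    ((x a * y b - y a * x b) • (x c • v + y c • w))
  rw [← e] at h1
  simp only [norm_smul, h.norm_eq, mul_one, Real.norm_eq_abs] at h1
  rwa [abs_of_pos (h.det_pos a c (by omega) hca), abs_of_pos (h.det_pos b c hbc (by omega)),
    abs_of_pos (h.det_pos a b hab (by omega))] at h1

/-- A linear function is monotone along half of an inscribed polygon, from a vertex where it is
maximal to the opposite vertex. -/
theorem antitone_of_isMax (h : IsInscribedPolygon v w n x y) {α β : ℝ} {F : ℕ → ℝ}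
    (hF : ∀ k, F k = α * x k + β * y k) {m : ℕ} (hm : ∀ k, F k ≤ F m) {i j : ℕ} (hmi : m ≤ i)
    (hij : i ≤ j) (hj : j ≤ m + n) : F j ≤ F i := by
  have hanti : ∀ k, F (k + n) = -F k := fun k => by
    rw [hF, hF, h.x_add, h.y_add]; ring
  have hmin : ∀ k, F (m + n) ≤ F k := fun k => by
    have := hm (k + n)
    rw [hanti] at this ⊢
    linarith
  have cramer : ∀ a b c, (x a * y c - y a * x c) * F b =
      (x b * y c - y b * x c) * F a + (x a * y b - y a * x b) * F c := by
    intro a b c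
    simp only [hF]; ring
  rcases hmi.eq_or_lt with rfl | hmi
  · exact hm j
  rcases hj.eq_or_lt with rfl | hj
  · exact hmin i
  rcases hij.eq_or_lt with rfl | hij
  · exact le_rfl
  by_contra! hlt
  -- If `F i ≥ 0`, vertex `i` lies between the maximum `m` and `j`; if `F i < 0`, vertex `j` lies
  -- between `i` and the minimum `m + n`. In each case `det_le_add`, multiplied by a number of known
  -- sign, contradicts `F i < F j`.
  rcases le_or_gt 0 (F i) with hi | hi
  · have hc := cramer m i j
    have d := h.det_le_add hmi hij hj
    have d1 := h.det_pos m j (by omega) hj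
    have d2 := h.det_pos i j hij (by omega)
    nlinarith [hm j, mul_le_mul_of_nonneg_left (hm j) d2.le,
      mul_le_mul_of_nonneg_right d (hi.trans hlt.le), mul_lt_mul_of_pos_left hlt d1]
  · have hc := cramer i j (m + n)
    have d := h.det_le_add (a := i) (b := j) (c := m + n) hij hj (by omega)
    have d1 := h.det_pos i (m + n) (by omega) (by omega)
    have d2 := h.det_pos i j hij (by omega)
    nlinarith [mul_le_mul_of_nonneg_left (hmin i) d2.le,
      mul_le_mul_of_nonneg_right d (neg_pos.2 hi).le, mul_lt_mul_of_pos_left hlt d1]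

/-- The variation of a linear function along half of an inscribed polygon is at most twice its
norm. -/
theorem sum_abs_le (h : IsInscribedPolygon v w n x y) (f : StrongDual ℝ V) :
    ∑ k ∈ Finset.range n, |f v * (x (k + 1) - x k) + f w * (y (k + 1) - y k)| ≤ 2 * ‖f‖ := by
  set F : ℕ → ℝ := fun k => f v * x k + f w * y k with hFdef
  have hF : ∀ k, F k = f v * x k + f w * y k := fun k => rfl
  have hanti : ∀ k, F (k + n) = -F k := fun k => by
    rw [hF, hF, h.x_add, h.y_add]; ring
  have hper : Function.Periodic F (n + n) := fun k => by
    rw [← add_assoc, hanti, hanti, neg_neg]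
  have hn := h.two_le
  obtain ⟨m, -, hm⟩ := (Finset.range (n + n)).exists_max_image F ⟨0, by simp; omega⟩
  have hmax : ∀ k, F k ≤ F m := fun k => by
    rw [← hper.map_mod_nat k]
    exact hm _ (Finset.mem_range.2 (Nat.mod_lt _ (by omega)))
  have hle : F m ≤ ‖f‖ := by
    have := f.le_opNorm (x m • v + y m • w)
    rw [h.norm_eq, mul_one] at this
    refine le_trans (le_of_eq ?_) ((le_abs_self _).trans this)
    rw [hF]
    simp only [map_add, map_smul, smul_eq_mul]
    ring
  have hterm : ∀ k, |f v * (x (k + 1) - x k) + f w * (y (k + 1) - y k)| = |F (k + 1) - F k| := by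
    intro k
    rw [hF, hF]; congr 1; ring
  simp only [hterm]
  -- The increments have period `n` in absolute value, so the half-turn may start at the maximum
  -- `m`, where the sum telescopes to `F m - F (m + n) = 2 * F m`.
  rw [← sum_range_add_of_periodic (g := fun k => |F (k + 1) - F k|) (fun k => by
    rw [show k + n + 1 = k + 1 + n by ring, hanti, hanti, ← abs_neg]; congr 1; ring) m]
  have : ∀ k ∈ Finset.range n, |F (m + k + 1) - F (m + k)| = F (m + k) - F (m + (k + 1)) := by
    intro k hk
    rw [abs_sub_comm]
    refine abs_of_nonneg (sub_nonneg.2 (h.antitone_of_isMax hF hmax ?_ ?_ ?_))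
    · omega
    · omega
    · have := Finset.mem_range.1 hk; omega
  rw [Finset.sum_congr rfl this, Finset.sum_range_sub' (fun k => F (m + k)), add_zero, hanti]
  linarith

/-- For fixed `k`, the inner sum is the variation over a half-turn of the determinant against edge
`k`. It is at least twice the value at vertex `k`, which is the `k`-th term of the area. -/
theorem two_mul_halfPolygonArea_le (h : IsInscribedPolygon v w n x y) :
    2 * halfPolygonArea n x y ≤ ∑ k ∈ Finset.range n, ∑ l ∈ Finset.range n,
      |(x (k + 1) - x k) * (y (l + 1) - y l) - (y (k + 1) - y k) * (x (l + 1) - x l)| := by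
  rw [halfPolygonArea, Finset.mul_sum]
  refine Finset.sum_le_sum fun k hk => ?_
  set F : ℕ → ℝ := fun l => x l * (y (k + 1) - y k) - y l * (x (k + 1) - x k) with hF
  have := two_mul_le_sum_abs_sub (F := F) (n := n) (fun l => by
    simp only [hF]; rw [h.x_add, h.y_add]; ring) (Finset.mem_range.1 hk).le
  refine le_trans (le_of_eq ?_) (this.trans (le_of_eq ?_))
  · simp only [hF]; ring
  · refine Finset.sum_congr rfl fun l _ => ?_
    simp only [hF]
    rw [← abs_neg]
    congr 1; ring

/-- The inequality between the area of a polygon inscribed in the unit circle and the area of the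
zonogon generated by linear functions. -/
theorem sum_abs_wedge_mul_le (h : IsInscribedPolygon v w n x y) {ι : Type*} [Fintype ι]
    (F : ι → StrongDual ℝ V) :
    (∑ i, ∑ j, |F i v * F j w - F i w * F j v|) * halfPolygonArea n x y ≤
      2 * (∑ i, ‖F i‖) ^ 2 := by
  set S := halfPolygonArea n x y
  set Q := ∑ i, ∑ j, |F i v * F j w - F i w * F j v|
  set W := ∑ i, ‖F i‖
  have hS : 0 < S := h.halfPolygonArea_pos
  set ex : Fin n → ℝ := fun k => x (k + 1) - x k with hex
  set ey : Fin n → ℝ := fun k => y (k + 1) - y k with hey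
  set E := ∑ k, ∑ l, |ex k * ey l - ey k * ex l| with hE
  have hES : 2 * S ≤ E := by
    refine h.two_mul_halfPolygonArea_le.trans (le_of_eq ?_)
    simp only [hE, hex, hey, Finset.sum_range]
  set M := ∑ i, ∑ k, |F i v * ex k + F i w * ey k| with hM
  have hMW : M ≤ 2 * W := by
    rw [hM, Finset.mul_sum]
    refine Finset.sum_le_sum fun i _ => ?_
    have := h.sum_abs_le (F i)
    rwa [Finset.sum_range] at this
  have hL : 0 < ∑ k, |ey k| := by
    refine lt_of_le_of_ne (Finset.sum_nonneg fun _ _ => abs_nonneg _) fun h0 => ?_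
    have h1 : ∀ k, ey k = 0 := fun k => by
      have := (Finset.sum_eq_zero_iff_of_nonneg (fun i _ => abs_nonneg (ey i))).1 h0.symm k
        (Finset.mem_univ k)
      simpa using this
    have : E = 0 := by simp [hE, h1]
    linarith
  -- This scale balances the functionals against the rotated edges `(ey, -ex)`, as the hypothesis of
  -- `sum_mul_abs_det_nonpos` demands.
  set t := (∑ i, |F i v|) / ∑ k, |ey k| with ht
  have ht0 : 0 ≤ t := div_nonneg (Finset.sum_nonneg fun _ _ => abs_nonneg _) hL.le
  have hcnd := sum_mul_abs_det_nonpos (Sum.elim (fun _ : ι => (1 : ℝ)) (fun _ : Fin n => -t))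
    (Sum.elim (fun i => F i v) ey) (Sum.elim (fun i => F i w) (fun k => -ex k)) (by
      simp only [Fintype.sum_sum_type, Sum.elim_inl, Sum.elim_inr, one_mul, ← Finset.mul_sum]
      rw [ht]; field_simp; ring)
  have e1 : ∀ i k, |F i v * -ex k - F i w * ey k| = |F i v * ex k + F i w * ey k| := by
    intro i k
    rw [← abs_neg]; congr 1; ring
  have e2 : ∀ k i, |ey k * F i w - -ex k * F i v| = |F i v * ex k + F i w * ey k| := by
    intro i k
    congr 1; ring
  have e3 : ∀ k l, |ey k * -ex l - -ex k * ey l| = |ex k * ey l - ey k * ex l| := by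
    intro i k
    congr 1; ring
  simp only [Fintype.sum_sum_type, Sum.elim_inl, Sum.elim_inr, one_mul, mul_one,
    Finset.sum_add_distrib, e1, e2, e3, ← Finset.mul_sum] at hcnd
  rw [Finset.sum_comm (s := (Finset.univ : Finset (Fin n))) (t := (Finset.univ : Finset ι))]
    at hcnd
  have hmain : Q + -t * M + (-t * M + -t * -t * E) ≤ 0 := hcnd
  have : Q ≤ 4 * t * W - 2 * S * t ^ 2 := by
    nlinarith [mul_le_mul_of_nonneg_left hMW ht0, mul_le_mul_of_nonneg_left hES (sq_nonneg t)]
  -- The quadratic in `t` is maximal at `t = W / S`; completing the square removes `t`.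
  nlinarith [mul_le_mul_of_nonneg_right this hS.le, sq_nonneg (S * t - W)]

end IsInscribedPolygon

/-! ### Passage from polygons to the unit disc. -/

open Filter Topology in
/-- Riemann sums for the integral of the square of a continuous function. -/
theorem tendsto_sum_mul_succ {h : ℝ → ℝ} (hc : Continuous h) :
    Tendsto (fun n : ℕ => Real.pi / n * ∑ k ∈ Finset.range n,
      h (k * (Real.pi / n)) * h ((k + 1 : ℕ) * (Real.pi / n))) atTop
      (𝓝 (∫ θ in (0 : ℝ)..Real.pi, h θ ^ 2)) := by
  rw [Metric.tendsto_atTop]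
  intro ε hε
  have hpi := Real.pi_pos
  -- Continuity on the square compares the product at two consecutive nodes with the diagonal value
  -- `h θ * h θ` between them.
  have huc : UniformContinuousOn (fun p : ℝ × ℝ => h p.1 * h p.2)
      (Set.Icc 0 Real.pi ×ˢ Set.Icc 0 Real.pi) :=
    (isCompact_Icc.prod isCompact_Icc).uniformContinuousOn_of_continuous (by fun_prop)
  rw [Metric.uniformContinuousOn_iff] at huc
  obtain ⟨δ, hδ, huc⟩ := huc (ε / (2 * Real.pi)) (by positivity)
  obtain ⟨N, hN⟩ := exists_nat_gt (Real.pi / δ)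
  refine ⟨N + 1, fun n hn => ?_⟩
  have hn0 : (0 : ℝ) < n := by exact_mod_cast (by omega : 0 < n)
  set d := Real.pi / n with hd
  have hd0 : 0 < d := by positivity
  have hnd : n * d = Real.pi := by rw [hd]; field_simp
  have hdδ : d < δ := by
    have h1 : Real.pi / δ < n := hN.trans (by exact_mod_cast (by omega : N < n))
    rw [div_lt_iff₀ hδ] at h1
    rw [hd, div_lt_iff₀ hn0]
    linarith
  have hint : ∀ a b : ℝ, IntervalIntegrable (fun θ => h θ ^ 2) volume a b := fun a b =>
    (by fun_prop : Continuous fun θ => h θ ^ 2).intervalIntegrable a b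
  have hsplit := intervalIntegral.sum_integral_adjacent_intervals (f := fun θ => h θ ^ 2)
    (μ := volume) (a := fun k : ℕ => k * d) (n := n) fun k _ => hint _ _
  simp only [Nat.cast_zero, zero_mul, hnd] at hsplit
  rw [← hsplit, Finset.mul_sum, dist_eq_norm, ← Finset.sum_sub_distrib]
  have hterm : ∀ k ∈ Finset.range n, ‖d * (h (k * d) * h ((k + 1 : ℕ) * d)) -
      ∫ θ in (k * d)..((k + 1 : ℕ) * d), h θ ^ 2‖ ≤ ε / (2 * Real.pi) * d := by
    intro k hk
    have hk' : ((k + 1 : ℕ) : ℝ) ≤ n := by exact_mod_cast Finset.mem_range.1 hk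
    have hkd : ((k + 1 : ℕ) : ℝ) * d = k * d + d := by push_cast; ring
    have hk1 : k * d + d ≤ Real.pi := by
      rw [← hkd, ← hnd]; exact mul_le_mul_of_nonneg_right hk' hd0.le
    have hk0 : 0 ≤ k * d := by positivity
    have e : d * (h (k * d) * h ((k + 1 : ℕ) * d)) =
        ∫ θ in (k * d)..((k + 1 : ℕ) * d), h (k * d) * h ((k + 1 : ℕ) * d) := by
      rw [intervalIntegral.integral_const, smul_eq_mul, hkd]; ring
    rw [e, ← intervalIntegral.integral_sub intervalIntegrable_const (hint _ _), hkd]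
    refine (intervalIntegral.norm_integral_le_of_norm_le_const
      (C := ε / (2 * Real.pi)) fun θ hθ => ?_).trans (le_of_eq ?_)
    · rw [Set.uIoc_of_le (by linarith)] at hθ
      have := huc (k * d, k * d + d) ⟨⟨hk0, by linarith⟩, ⟨by linarith, hk1⟩⟩ (θ, θ)
        ⟨⟨by linarith [hθ.1], by linarith [hθ.2]⟩, ⟨by linarith [hθ.1], by linarith [hθ.2]⟩⟩ (by
          rw [Prod.dist_eq, max_lt_iff, Real.dist_eq, Real.dist_eq, abs_lt, abs_lt]
          refine ⟨⟨?_, ?_⟩, ⟨?_, ?_⟩⟩ <;> linarith [hθ.1, hθ.2])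
      rw [dist_eq_norm, ← sq] at this
      exact this.le
    · rw [add_sub_cancel_left, abs_of_pos hd0]
  refine (norm_sum_le_of_le _ hterm).trans_lt ?_
  rw [Finset.sum_const, Finset.card_range, nsmul_eq_mul, mul_left_comm, hnd]
  field_simp
  norm_num

section

variable {V : Type*} [NormedAddCommGroup V] [NormedSpace ℝ V]

/-- The area of the unit disc of the plane spanned by `v` and `w`, in the coordinates given by
the basis `v`, `w`, as an integral in polar coordinates. -/
noncomputable def radialArea (v w : V) : ℝ :=
  ∫ θ in (0 : ℝ)..Real.pi, ‖Real.cos θ • v + Real.sin θ • w‖⁻¹ ^ 2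

theorem cos_smul_add_sin_smul_ne_zero {v w : V} (hvw : LinearIndependent ℝ ![v, w]) (θ : ℝ) :
    Real.cos θ • v + Real.sin θ • w ≠ 0 := by
  intro h
  obtain ⟨h1, h2⟩ := LinearIndependent.pair_iff.1 hvw _ _ h
  have := Real.sin_sq_add_cos_sq θ
  simp [h1, h2] at this

theorem continuous_inv_norm_cos_sin {v w : V} (hvw : LinearIndependent ℝ ![v, w]) :
    Continuous fun θ : ℝ => ‖Real.cos θ • v + Real.sin θ • w‖⁻¹ :=
  Continuous.inv₀ (by fun_prop) fun θ => norm_ne_zero_iff.2 (cos_smul_add_sin_smul_ne_zero hvw θ)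

theorem radialArea_pos {v w : V} (hvw : LinearIndependent ℝ ![v, w]) : 0 < radialArea v w := by
  refine intervalIntegral.intervalIntegral_pos_of_pos
    (((continuous_inv_norm_cos_sin hvw).pow 2).intervalIntegrable _ _) (fun θ => ?_) Real.pi_pos
  have := norm_pos_iff.2 (cos_smul_add_sin_smul_ne_zero hvw θ)
  positivity

/-- The vertices, in the coordinates given by `v` and `w`, of the polygon with `2 * n` vertices
inscribed in the unit circle at equally spaced angles: the first coordinate for `c = cos`, the
second for `c = sin`. -/
noncomputable def vertexCoord (v w : V) (c : ℝ → ℝ) (n k : ℕ) : ℝ :=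
  ‖Real.cos (k * (Real.pi / n)) • v + Real.sin (k * (Real.pi / n)) • w‖⁻¹ *
    c (k * (Real.pi / n))

theorem isInscribedPolygon_vertexCoord {v w : V} (hvw : LinearIndependent ℝ ![v, w]) {n : ℕ}
    (hn : 2 ≤ n) :
    IsInscribedPolygon v w n (vertexCoord v w Real.cos n) (vertexCoord v w Real.sin n) := by
  have hn0 : (0 : ℝ) < n := by exact_mod_cast (by omega : 0 < n)
  have hpos : ∀ θ, 0 < ‖Real.cos θ • v + Real.sin θ • w‖⁻¹ := fun θ =>
    inv_pos.2 (norm_pos_iff.2 (cos_smul_add_sin_smul_ne_zero hvw θ))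
  have hadd : ∀ k : ℕ, ((k + n : ℕ) : ℝ) * (Real.pi / n) = k * (Real.pi / n) + Real.pi := by
    intro k
    push_cast; field_simp
  have hnorm : ∀ θ : ℝ, ‖Real.cos (θ + Real.pi) • v + Real.sin (θ + Real.pi) • w‖ =
      ‖Real.cos θ • v + Real.sin θ • w‖ := by
    intro θ
    rw [Real.cos_add_pi, Real.sin_add_pi, ← norm_neg]
    congr 1; module
  refine ⟨fun k => ?_, fun k => ?_, fun k => ?_, fun k l hkl hlk => ?_, hn⟩
  · have := hpos (k * (Real.pi / n))
    rw [vertexCoord, vertexCoord, mul_smul, mul_smul, ← smul_add, norm_smul, norm_inv, norm_norm]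
    exact inv_mul_cancel₀ (inv_pos.1 this).ne'
  · rw [vertexCoord, vertexCoord, hadd, hnorm, Real.cos_add_pi]; ring
  · rw [vertexCoord, vertexCoord, hadd, hnorm, Real.sin_add_pi]; ring
  · have h1 := hpos (k * (Real.pi / n))
    have h2 := hpos (l * (Real.pi / n))
    have hkl' : (k : ℝ) < l := by exact_mod_cast hkl
    have hlk' : (l : ℝ) < k + n := by exact_mod_cast hlk
    have h3 : 0 < Real.sin (l * (Real.pi / n) - k * (Real.pi / n)) := by
      refine Real.sin_pos_of_pos_of_lt_pi ?_ ?_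
      · rw [← sub_mul]
        exact mul_pos (sub_pos.2 hkl') (by positivity)
      · calc l * (Real.pi / n) - k * (Real.pi / n) = (l - k) * (Real.pi / n) := by ring
          _ < n * (Real.pi / n) := by
            refine mul_lt_mul_of_pos_right (by linarith) (by positivity)
          _ = Real.pi := by field_simp
    rw [Real.sin_sub] at h3
    simp only [vertexCoord]
    nlinarith [mul_pos (mul_pos h1 h2) h3]

-- The triangle on two consecutive vertices contributes the product of their radii times `sin (π /
-- n)`; replacing the sine by `π / n` costs a factor `sinc (π / n) → 1` and leaves a Riemann sum.
open Filter Topology in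
theorem tendsto_halfPolygonArea {v w : V} (hvw : LinearIndependent ℝ ![v, w]) :
    Tendsto (fun n => halfPolygonArea n (vertexCoord v w Real.cos n) (vertexCoord v w Real.sin n))
      atTop (𝓝 (radialArea v w)) := by
  have h1 := tendsto_sum_mul_succ (continuous_inv_norm_cos_sin hvw)
  have h2 : Tendsto (fun n : ℕ => Real.sinc (Real.pi / n)) atTop (𝓝 1) := by
    have := Real.continuous_sinc.tendsto 0
    rw [Real.sinc_zero] at this
    exact this.comp (tendsto_const_div_atTop_nhds_zero_nat Real.pi)
  have h3 := h2.mul h1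
  rw [one_mul] at h3
  refine h3.congr' ?_
  filter_upwards [eventually_gt_atTop 0] with n hn
  have hn0 : (0 : ℝ) < n := by exact_mod_cast hn
  have hd : Real.pi / n ≠ 0 := (div_pos Real.pi_pos hn0).ne'
  rw [Real.sinc_of_ne_zero hd, ← mul_assoc, div_mul_cancel₀ _ hd, halfPolygonArea, Finset.mul_sum]
  refine Finset.sum_congr rfl fun k _ => ?_
  have : Real.sin (Real.pi / n) = Real.sin ((k + 1 : ℕ) * (Real.pi / n) - k * (Real.pi / n)) := by
    congr 1; push_cast; ring
  rw [this, Real.sin_sub]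
  simp only [vertexCoord]
  ring

open Filter in
theorem eventually_norm_vertex_sub_le {v w : V} (hvw : LinearIndependent ℝ ![v, w]) {δ : ℝ}
    (hδ : 0 < δ) : ∀ᶠ n : ℕ in atTop, ∀ k < n,
      ‖(vertexCoord v w Real.cos n (k + 1) • v + vertexCoord v w Real.sin n (k + 1) • w) -
        (vertexCoord v w Real.cos n k • v + vertexCoord v w Real.sin n k • w)‖ ≤ δ := by
  set P : ℝ → V := fun θ => ‖Real.cos θ • v + Real.sin θ • w‖⁻¹ •
    (Real.cos θ • v + Real.sin θ • w) with hP
  have hPc : Continuous P := (continuous_inv_norm_cos_sin hvw).smul (by fun_prop)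
  have huc := isCompact_Icc (a := (0 : ℝ)) (b := Real.pi) |>.uniformContinuousOn_of_continuous
    hPc.continuousOn
  rw [Metric.uniformContinuousOn_iff] at huc
  obtain ⟨η, hη, huc⟩ := huc δ hδ
  have hev := (tendsto_const_div_atTop_nhds_zero_nat Real.pi).eventually_lt_const hη
  filter_upwards [hev, eventually_gt_atTop 0] with n hn hn0 k hk
  have hn0' : (0 : ℝ) < n := by exact_mod_cast hn0
  have hd := div_pos Real.pi_pos hn0'
  have hmem : ∀ j : ℕ, j ≤ n → (j * (Real.pi / n)) ∈ Set.Icc 0 Real.pi := by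
    intro j hj
    have hj' : (j : ℝ) ≤ n := by exact_mod_cast hj
    refine ⟨by positivity, (mul_le_mul_of_nonneg_right hj' hd.le).trans (le_of_eq ?_)⟩
    field_simp
  have := huc _ (hmem (k + 1) hk) _ (hmem k hk.le) (by
    rw [Real.dist_eq, ← sub_mul]
    push_cast
    rw [add_sub_cancel_left, one_mul, abs_of_pos hd]
    exact hn)
  rw [dist_eq_norm] at this
  refine le_trans (le_of_eq ?_) this.le
  simp only [hP, vertexCoord, mul_smul, smul_add]

/-- The inequality between the area of the unit disc of a plane and the area of the zonogon
generated by linear functions. -/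
theorem sum_abs_wedge_mul_radialArea_le {v w : V} (hvw : LinearIndependent ℝ ![v, w])
    {ι : Type*} [Fintype ι] (F : ι → StrongDual ℝ V) :
    (∑ i, ∑ j, |F i v * F j w - F i w * F j v|) * radialArea v w ≤ 2 * (∑ i, ‖F i‖) ^ 2 := by
  refine le_of_tendsto ((tendsto_halfPolygonArea hvw).const_mul _) ?_
  filter_upwards [Filter.eventually_ge_atTop 2] with n hn
  exact (isInscribedPolygon_vertexCoord hvw hn).sum_abs_wedge_mul_le F

/-! ### Sharpness of the inequality. -/

/-- The function `s + t` equals one on the line through the nearby unit vectors `a` and `b`, so its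
norm on their plane should be close to one. For coefficients of the same sign, move `b` to `a`; for
opposite signs the reverse triangle inequality suffices, without loss. -/
theorem abs_add_mul_le_norm_smul_add_smul {a b : V} (ha : ‖a‖ = 1) (hb : ‖b‖ = 1) {δ : ℝ}
    (hδ : ‖b - a‖ ≤ δ) (s t : ℝ) : |s + t| * (1 - δ) ≤ ‖s • a + t • b‖ := by
  have hδ0 : 0 ≤ δ := (norm_nonneg _).trans hδ
  by_cases hst : 0 ≤ s * t
  · have ht : |t| ≤ |s + t| := by
      refine sq_le_sq.1 ?_
      nlinarith [sq_nonneg s]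
    have h1 : |s + t| ≤ ‖s • a + t • b‖ + |t| * ‖b - a‖ := by
      have := norm_sub_le (s • a + t • b) (t • (b - a))
      rw [norm_smul, Real.norm_eq_abs] at this
      rw [show s • a + t • b - t • (b - a) = (s + t) • a by module, norm_smul, ha, mul_one,
        Real.norm_eq_abs] at this
      exact this
    nlinarith [mul_le_mul ht hδ (norm_nonneg _) (abs_nonneg _)]
  · have h1 : |s + t| ≤ |‖s • a‖ - ‖-(t • b)‖| := by
      rw [norm_neg, norm_smul, norm_smul, ha, hb, mul_one, mul_one, Real.norm_eq_abs,
        Real.norm_eq_abs]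
      refine sq_le_sq.1 ?_
      have : |s| * |t| = -(s * t) := by rw [← abs_mul, abs_of_neg (not_le.1 hst)]
      nlinarith [sq_abs s, sq_abs t]
    have h2 := abs_norm_sub_norm_le (s • a) (-(t • b))
    rw [sub_neg_eq_add] at h2
    nlinarith [abs_nonneg (s + t)]

/-- The linear function on the plane spanned by `v` and `w` that is constant on a short edge of an
inscribed polygon extends to a function of almost the expected norm. -/
theorem exists_strongDual_of_vertices {v w : V} (hvw : LinearIndependent ℝ ![v, w])
    {x₀ y₀ x₁ y₁ δ : ℝ} (h₀ : ‖x₀ • v + y₀ • w‖ = 1) (h₁ : ‖x₁ • v + y₁ • w‖ = 1)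
    (hdet : 0 < x₀ * y₁ - y₀ * x₁) (hδ1 : δ < 1)
    (hδ : ‖(x₁ • v + y₁ • w) - (x₀ • v + y₀ • w)‖ ≤ δ) :
    ∃ Φ : StrongDual ℝ V, Φ v = y₁ - y₀ ∧ Φ w = -(x₁ - x₀) ∧
      ‖Φ‖ ≤ (x₀ * y₁ - y₀ * x₁) / (1 - δ) := by
  set D := x₀ * y₁ - y₀ * x₁ with hD
  have hδ1' : 0 < 1 - δ := by linarith
  set g : ℝ × ℝ →ₗ[ℝ] V :=
    (LinearMap.fst ℝ ℝ ℝ).smulRight v + (LinearMap.snd ℝ ℝ ℝ).smulRight w with hg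
  have hgapp : ∀ p, g p = p.1 • v + p.2 • w := fun p => rfl
  have hinj : Function.Injective g := by
    rw [← LinearMap.ker_eq_bot, LinearMap.ker_eq_bot']
    intro p hp
    obtain ⟨h1, h2⟩ := LinearIndependent.pair_iff.1 hvw _ _ hp
    exact Prod.ext h1 h2
  set e := LinearEquiv.ofInjective g hinj
  set φ : ℝ × ℝ →ₗ[ℝ] ℝ := (y₁ - y₀) • LinearMap.fst ℝ ℝ ℝ - (x₁ - x₀) • LinearMap.snd ℝ ℝ ℝ
  have hφ : ∀ p, φ p = (y₁ - y₀) * p.1 - (x₁ - x₀) * p.2 := fun p => rfl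
  have hbound : ∀ p, |φ p| ≤ D / (1 - δ) * ‖g p‖ := by
    intro p
    -- The last two arguments are, up to the factor `D`, the coordinates of `g p` in the basis of
    -- the two vertices; their sum is `φ p`.
    have key := abs_add_mul_le_norm_smul_add_smul h₀ h₁ hδ (p.1 * y₁ - p.2 * x₁)
      (x₀ * p.2 - y₀ * p.1)
    have e1 : (p.1 * y₁ - p.2 * x₁) • (x₀ • v + y₀ • w) +
        (x₀ * p.2 - y₀ * p.1) • (x₁ • v + y₁ • w) = D • g p := by
      rw [hgapp, hD]; module
    rw [e1, norm_smul, Real.norm_eq_abs, abs_of_pos hdet] at key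
    have e2 : φ p = p.1 * y₁ - p.2 * x₁ + (x₀ * p.2 - y₀ * p.1) := by rw [hφ]; ring
    rw [e2, div_mul_eq_mul_div, le_div_iff₀ hδ1']
    exact key
  set f : StrongDual ℝ (LinearMap.range g) := (φ ∘ₗ e.symm.toLinearMap).mkContinuous (D / (1 - δ))
    (fun z => by
      obtain ⟨p, rfl⟩ := e.surjective z
      have : g p = e p := rfl
      simpa [this] using hbound p) with hf
  obtain ⟨Φ, hΦ, hnorm⟩ := exists_extension_norm_eq _ f
  have hval : ∀ p, Φ (g p) = φ p := by
    intro p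
    have := hΦ (e p)
    simpa [hf, e] using this
  refine ⟨Φ, ?_, ?_, ?_⟩
  · have := hval (1, 0)
    rw [hgapp, hφ] at this
    simpa using this
  · have := hval (0, 1)
    rw [hgapp, hφ] at this
    simpa using this
  · rw [hnorm]
    exact LinearMap.mkContinuous_norm_le _ (div_pos hdet hδ1').le _

/-- The inequality `sum_abs_wedge_mul_radialArea_le` is sharp. -/
theorem exists_lt_sum_abs_wedge_mul_radialArea {v w : V} (hvw : LinearIndependent ℝ ![v, w])
    {c : ℝ} (hc : c < 2) : ∃ (n : ℕ) (F : Fin n → StrongDual ℝ V), 0 < ∑ i, ‖F i‖ ∧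
      c * (∑ i, ‖F i‖) ^ 2 ≤ (∑ i, ∑ j, |F i v * F j w - F i w * F j v|) * radialArea v w := by
  have hA := radialArea_pos hvw
  -- Two factors `1 - δ` pay for the norms of the extended functionals, which enter squared, and one
  -- for comparing the polygon with the disc.
  obtain ⟨δ, hδ0, hδ1, hδ⟩ : ∃ δ : ℝ, 0 < δ ∧ δ < 1 ∧ c < 2 * (1 - δ) ^ 3 := by
    have hlim : Filter.Tendsto (fun δ : ℝ => 2 * (1 - δ) ^ 3) (nhdsWithin 0 (Set.Ioi 0))
        (nhds 2) := by
      have : Continuous fun δ : ℝ => 2 * (1 - δ) ^ 3 := by fun_prop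
      have := (this.tendsto 0).mono_left (nhdsWithin_le_nhds (s := Set.Ioi 0))
      simpa using this
    have := (hlim.eventually_const_lt hc).and
      (Ioo_mem_nhdsGT (show (0 : ℝ) < 1 by norm_num))
    obtain ⟨δ, h1, h2⟩ := this.exists
    exact ⟨δ, h2.1, h2.2, h1⟩
  have hδ1' : 0 < 1 - δ := by linarith
  have hlt : (1 - δ) * radialArea v w < radialArea v w := by nlinarith
  have hev : ∀ᶠ n in Filter.atTop,
      halfPolygonArea n (vertexCoord v w Real.cos n) (vertexCoord v w Real.sin n)
        * (1 - δ) < radialArea v w := by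
    refine ((tendsto_halfPolygonArea hvw).mul_const (1 - δ)).eventually_lt_const ?_
    linarith
  obtain ⟨n, hnA, hn2, hnδ⟩ := (hev.and ((Filter.eventually_ge_atTop 2).and
    (eventually_norm_vertex_sub_le hvw hδ0))).exists
  have hp := isInscribedPolygon_vertexCoord hvw hn2
  set x := vertexCoord v w Real.cos n
  set y := vertexCoord v w Real.sin n
  choose F hFv hFw hFn using fun k : Fin n => exists_strongDual_of_vertices hvw (hp.norm_eq k)
    (hp.norm_eq (k + 1)) (hp.det_succ_pos k) hδ1 (hnδ k k.2)
  set S := halfPolygonArea n x y with hSdef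
  have hS : 0 < S := hp.halfPolygonArea_pos
  have hW : ∑ i, ‖F i‖ ≤ S / (1 - δ) := by
    rw [hSdef, halfPolygonArea, Finset.sum_range, Finset.sum_div]
    exact Finset.sum_le_sum fun k _ => hFn k
  have hE : 2 * S ≤ ∑ i, ∑ j, |F i v * F j w - F i w * F j v| := by
    refine hp.two_mul_halfPolygonArea_le.trans (le_of_eq ?_)
    simp only [hFv, hFw, Finset.sum_range]
    refine Finset.sum_congr rfl fun k _ => Finset.sum_congr rfl fun l _ => ?_
    congr 1; ring
  have hW0 : 0 ≤ ∑ i, ‖F i‖ := Finset.sum_nonneg fun _ _ => norm_nonneg _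
  refine ⟨n, F, lt_of_le_of_ne hW0 fun h0 => ?_, ?_⟩
  · have hz : ∀ i, F i = 0 := fun i => by
      have := (Finset.sum_eq_zero_iff_of_nonneg (fun i _ => norm_nonneg (F i))).1 h0.symm i
        (Finset.mem_univ i)
      simpa using this
    simp only [hz, zero_apply, mul_zero, sub_zero, abs_zero,
      Finset.sum_const_zero] at hE
    linarith
  · have h1 : (∑ i, ‖F i‖) ^ 2 ≤ (S / (1 - δ)) ^ 2 := pow_le_pow_left₀ hW0 hW 2
    calc c * (∑ i, ‖F i‖) ^ 2 ≤ 2 * (1 - δ) ^ 3 * (∑ i, ‖F i‖) ^ 2 :=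
          mul_le_mul_of_nonneg_right hδ.le (sq_nonneg _)
      _ ≤ 2 * (1 - δ) ^ 3 * (S / (1 - δ)) ^ 2 := by gcongr
      _ = 2 * S * (S * (1 - δ)) := by field_simp
      _ ≤ 2 * S * radialArea v w := by gcongr
      _ ≤ _ := by gcongr

end

/-! ### The Busemann density as `π` over the area of the unit disc. -/

theorem eq_vecCons_fin_two {α : Type*} (v : Fin 2 → α) : v = ![v 0, v 1] := by
  funext i; fin_cases i <;> rfl

section

variable {V : Type*} [NormedAddCommGroup V] [NormedSpace ℝ V]

theorem integral_inv_norm_sq_eq_radialArea {v w : V} (hvw : LinearIndependent ℝ ![v, w]) :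
    ∫ θ in (-Real.pi)..Real.pi, ‖Real.cos θ • v + Real.sin θ • w‖⁻¹ ^ 2 / 2 = radialArea v w := by
  set g : ℝ → ℝ := fun θ => ‖Real.cos θ • v + Real.sin θ • w‖⁻¹ ^ 2 with hg
  have hgc : Continuous g := (continuous_inv_norm_cos_sin hvw).pow 2
  have hper : Function.Periodic g Real.pi := fun θ => by
    simp only [hg]
    rw [Real.cos_add_pi, Real.sin_add_pi, ← norm_neg]
    congr 3; module
  have h1 := hper.intervalIntegral_add_eq (-Real.pi) 0
  rw [neg_add_cancel, zero_add] at h1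
  rw [intervalIntegral.integral_div, ← intervalIntegral.integral_add_adjacent_intervals
    (hgc.intervalIntegrable (-Real.pi) 0) (hgc.intervalIntegrable 0 Real.pi), h1, radialArea]
  ring

theorem volume_setOf_norm_le_one {v w : V} (hvw : LinearIndependent ℝ ![v, w]) :
    volume {p : ℝ × ℝ | ‖p.1 • v + p.2 • w‖ ≤ 1} = ENNReal.ofReal (radialArea v w) := by
  set h : ℝ → ℝ := fun θ => ‖Real.cos θ • v + Real.sin θ • w‖⁻¹ with hh
  have hc : Continuous h := continuous_inv_norm_cos_sin hvw
  have hpos : ∀ θ, 0 < ‖Real.cos θ • v + Real.sin θ • w‖ := fun θ =>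
    norm_pos_iff.2 (cos_smul_add_sin_smul_ne_zero hvw θ)
  have hh0 : ∀ θ, 0 < h θ := fun θ => inv_pos.2 (hpos θ)
  set B : Set (ℝ × ℝ) := {p | ‖p.1 • v + p.2 • w‖ ≤ 1} with hB
  have hBm : MeasurableSet B := by
    have : IsClosed B := isClosed_le (by fun_prop) continuous_const
    exact this.measurableSet
  set G : ℝ × ℝ → ℝ≥0∞ := fun p => ENNReal.ofReal p.1 * B.indicator 1 (polarCoord.symm p) with hG
  have hGm : Measurable G :=
    (by fun_prop : Measurable fun p : ℝ × ℝ => ENNReal.ofReal p.1).mul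
      ((measurable_one.indicator hBm).comp continuous_polarCoord_symm.measurable)
  have hinner : ∀ θ, ∫⁻ r in Set.Ioi (0 : ℝ), G (r, θ) = ENNReal.ofReal (h θ ^ 2 / 2) := by
    intro θ
    have e : ∀ r ∈ Set.Ioi (0 : ℝ), G (r, θ) =
        (Set.Iic (h θ)).indicator (fun r => ENNReal.ofReal r) r := by
      intro r hr
      replace hr : 0 < r := hr
      have hmem : polarCoord.symm (r, θ) ∈ B ↔ r ∈ Set.Iic (h θ) := by
        change ‖(r * Real.cos θ) • v + (r * Real.sin θ) • w‖ ≤ 1 ↔ r ≤ h θ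
        rw [mul_smul, mul_smul, ← smul_add, norm_smul, Real.norm_eq_abs, abs_of_pos hr,
          show h θ = 1 / ‖Real.cos θ • v + Real.sin θ • w‖ from (one_div _).symm,
          le_div_iff₀ (hpos θ)]
      by_cases hm : r ∈ Set.Iic (h θ)
      · simp only [hG, Set.indicator_of_mem hm, Set.indicator_of_mem (hmem.2 hm), Pi.one_apply,
          mul_one]
      · simp only [hG, Set.indicator_of_notMem hm, Set.indicator_of_notMem (mt hmem.1 hm),
          mul_zero]
    rw [setLIntegral_congr_fun measurableSet_Ioi e, lintegral_indicator measurableSet_Iic,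
      Measure.restrict_restrict measurableSet_Iic, Set.Iic_inter_Ioi,
      ← ofReal_integral_eq_lintegral_ofReal, ← intervalIntegral.integral_of_le (hh0 θ).le,
      integral_id]
    · congr 1; ring
    · exact (continuous_id.intervalIntegrable 0 (h θ)).1
    · exact (ae_restrict_iff' measurableSet_Ioc).2 (Filter.Eventually.of_forall fun r hr => hr.1.le)
  calc volume B = ∫⁻ p, B.indicator 1 p := by rw [lintegral_indicator_one hBm]
    _ = ∫⁻ p in polarCoord.target, ENNReal.ofReal p.1 • B.indicator 1 (polarCoord.symm p) :=
        (lintegral_comp_polarCoord_symm _).symm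
    _ = ∫⁻ p, G p ∂((volume.restrict (Set.Ioi 0)).prod
          (volume.restrict (Set.Ioo (-Real.pi) Real.pi))) := by
        rw [polarCoord_target, Measure.prod_restrict]; rfl
    _ = ∫⁻ θ in Set.Ioo (-Real.pi) Real.pi, ENNReal.ofReal (h θ ^ 2 / 2) := by
        rw [lintegral_prod_symm _ hGm.aemeasurable]
        simp only [hinner]
    _ = ENNReal.ofReal (∫ θ in Set.Ioc (-Real.pi) Real.pi, h θ ^ 2 / 2) := by
        rw [← restrict_Ioo_eq_restrict_Ioc, ofReal_integral_eq_lintegral_ofReal]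
        · have : IntervalIntegrable (fun θ => h θ ^ 2 / 2) volume (-Real.pi) Real.pi :=
            (by fun_prop : Continuous fun θ => h θ ^ 2 / 2).intervalIntegrable _ _
          exact this.1.mono_set Set.Ioo_subset_Ioc_self
        · exact Filter.Eventually.of_forall fun θ => by positivity
    _ = _ := by
        rw [← integral_inv_norm_sq_eq_radialArea hvw,
          intervalIntegral.integral_of_le (by linarith [Real.pi_pos])]

/-- The Busemann `2`-volume density in terms of the area of the unit disc. -/
theorem busemannDensity_eq [MeasurableSpace V] [BorelSpace V] {v : Fin 2 → V}
    (hv : LinearIndependent ℝ v) : busemannDensity v = Real.pi / radialArea (v 0) (v 1) := by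
  have hv' : LinearIndependent ℝ ![v 0, v 1] := by rwa [← eq_vecCons_fin_two v]
  have hA := radialArea_pos hv'
  rw [busemannDensity, if_pos hv]
  have : FiniteDimensional ℝ (Submodule.span ℝ (Set.range v)) :=
    FiniteDimensional.span_of_finite ℝ (Set.finite_range v)
  set W := Submodule.span ℝ (Set.range v) with hW
  have : ProperSpace W := FiniteDimensional.proper_real W
  have : SecondCountableTopology W := secondCountable_of_proper
  set b : Basis (Fin 2) ℝ W := Basis.span hv with hb
  have hbv : ∀ i, ((b i : W) : V) = v i := fun i => by rw [hb, Basis.span_apply]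
  have hrank : finrank ℝ W = 2 := by rw [finrank_eq_card_basis b, Fintype.card_fin]
  set f : (ℝ × ℝ) ≃L[ℝ] W :=
    ((LinearEquiv.finTwoArrow ℝ ℝ).symm.trans b.equivFun.symm).toContinuousLinearEquiv with hf
  have hfapp : ∀ p : ℝ × ℝ, f p = p.1 • b 0 + p.2 • b 1 := by
    intro p
    change b.equivFun.symm ![p.1, p.2] = _
    rw [Basis.equivFun_symm_apply, Fin.sum_univ_two]
    rfl
  have hfV : ∀ p : ℝ × ℝ, ((f p : W) : V) = p.1 • v 0 + p.2 • v 1 := by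
    intro p
    rw [hfapp, Submodule.coe_add, Submodule.coe_smul, Submodule.coe_smul, hbv, hbv]
  set ν : Measure W := Measure.map f volume with hν
  have : ν.IsAddHaarMeasure := f.isAddHaarMeasure_map volume
  have hνapp : ∀ s, ν s = volume (f ⁻¹' s) := fun s =>
    f.toHomeomorph.measurableEmbedding.map_apply volume s
  have hpar : (fun i => (⟨v i, Submodule.subset_span (Set.mem_range_self i)⟩ : W)) = b := by
    funext i
    exact Subtype.ext (hbv i).symm
  have hνpar : ν (parallelepiped b) = 1 := by
    have hpre : f ⁻¹' (parallelepiped b) = Set.Icc (0 : ℝ) 1 ×ˢ Set.Icc (0 : ℝ) 1 := by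
      ext p
      have h0 : b.repr (f p) = b.repr (p.1 • b 0 + p.2 • b 1) := by rw [hfapp]
      have h1 : b.repr (f p) 0 = p.1 := by rw [h0]; simp
      have h2 : b.repr (f p) 1 = p.2 := by rw [h0]; simp
      rw [parallelepiped_basis_eq]
      simp only [Set.mem_preimage, Set.mem_ofPred_eq, Fin.forall_fin_two, h1, h2, Set.mem_prod]
    rw [hνapp, hpre, Measure.volume_eq_prod, Measure.prod_prod]
    simp
  have hνK : ν (unitBallCompacts W) = ENNReal.ofReal (radialArea (v 0) (v 1)) := by
    rw [hνapp, ← volume_setOf_norm_le_one hv']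
    congr 1
    ext p
    change f p ∈ Metric.closedBall (0 : W) 1 ↔ ‖p.1 • v 0 + p.2 • v 1‖ ≤ 1
    rw [mem_closedBall_zero_iff, ← hfV]
    rfl
  have huniq := Measure.addHaarMeasure_unique ν (unitBallCompacts W)
  have hH : (Measure.addHaarMeasure (unitBallCompacts W)).real (parallelepiped b) =
      (radialArea (v 0) (v 1))⁻¹ := by
    have h1 := hνpar
    rw [huniq, hνK, Measure.smul_apply, smul_eq_mul] at h1
    have h2 := congrArg ENNReal.toReal h1
    rw [ENNReal.toReal_mul, ENNReal.toReal_ofReal hA.le, ENNReal.toReal_one] at h2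
    exact eq_inv_of_mul_eq_one_right h2
  have hω : (euclideanBallVolume 2).toReal = Real.pi := by
    rw [euclideanBallVolume, EuclideanSpace.volume_closedBall_fin_two]
    simp [Real.pi_pos.le]
  rw [hpar, busemannMeasure, hrank, measureReal_def, Measure.smul_apply, smul_eq_mul,
    ENNReal.toReal_mul, hω, ← measureReal_def, hH, div_eq_mul_inv]

end

/-! ### Forms of finite rank and calibrations. -/

theorem alternatingMap_sum_apply {R M N ι κ : Type*} [CommSemiring R] [AddCommMonoid M]
    [Module R M] [AddCommMonoid N] [Module R N] (s : Finset κ) (f : κ → M [⋀^ι]→ₗ[R] N)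
    (v : ι → M) : (∑ k ∈ s, f k) v = ∑ k ∈ s, f k v := by
  classical
  induction s using Finset.induction_on with
  | empty => simp
  | insert a s ha ih => rw [Finset.sum_insert ha, Finset.sum_insert ha, AlternatingMap.add_apply, ih]

section

variable {V : Type*} [NormedAddCommGroup V] [NormedSpace ℝ V]

/-- The exterior product of two continuous linear functions. -/
noncomputable def wedge (F G : StrongDual ℝ V) : V [⋀^Fin 2]→ₗ[ℝ] ℝ :=
  Matrix.detRowAlternating.compLinearMap (LinearMap.pi ![F.toLinearMap, G.toLinearMap])

theorem wedge_apply (F G : StrongDual ℝ V) (v : Fin 2 → V) :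
    wedge F G v = F (v 0) * G (v 1) - F (v 1) * G (v 0) := by
  change Matrix.det (Matrix.of fun i => LinearMap.pi ![F.toLinearMap, G.toLinearMap] (v i)) = _
  rw [Matrix.det_fin_two]
  simp [mul_comm]

variable (V) in
/-- The `2`-forms that are linear combinations of exterior products of continuous linear
functions. -/
def finiteRankForms : Submodule ℝ (V [⋀^Fin 2]→ₗ[ℝ] ℝ) :=
  Submodule.span ℝ (Set.range fun p : StrongDual ℝ V × StrongDual ℝ V => wedge p.1 p.2)

theorem wedge_mem_finiteRankForms (F G : StrongDual ℝ V) : wedge F G ∈ finiteRankForms V :=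
  Submodule.subset_span ⟨(F, G), rfl⟩

/-- A form of finite rank is exact, with a linear primitive. -/
theorem exists_alternatizeUncurryFin_eq {Ω : V [⋀^Fin 2]→ₗ[ℝ] ℝ} (hΩ : Ω ∈ finiteRankForms V) :
    ∃ η : V →L[ℝ] V [⋀^Fin 1]→L[ℝ] ℝ,
      ∀ v, ContinuousAlternatingMap.alternatizeUncurryFin η v = Ω v := by
  induction hΩ using Submodule.span_induction with
  | mem Ω h =>
    obtain ⟨⟨F, G⟩, rfl⟩ := h
    -- The primitive `x ↦ F x • G` has exterior derivative `F ∧ G`.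
    refine ⟨F.smulRight (ContinuousAlternatingMap.ofSubsingleton ℝ V ℝ 0 G), fun v => ?_⟩
    rw [ContinuousAlternatingMap.alternatizeUncurryFin_apply, Fin.sum_univ_two, wedge_apply]
    simp [Fin.removeNth, Fin.tail, sub_eq_add_neg]
  | zero =>
    refine ⟨0, fun v => ?_⟩
    rw [ContinuousAlternatingMap.alternatizeUncurryFin_apply]
    simp
  | add Ω₁ Ω₂ _ _ h₁ h₂ =>
    obtain ⟨η₁, h₁⟩ := h₁
    obtain ⟨η₂, h₂⟩ := h₂
    refine ⟨η₁ + η₂, fun v => ?_⟩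
    rw [ContinuousAlternatingMap.alternatizeUncurryFin_add, ContinuousAlternatingMap.add_apply,
      h₁, h₂, AlternatingMap.add_apply]
  | smul c Ω _ h =>
    obtain ⟨η, h⟩ := h
    refine ⟨c • η, fun v => ?_⟩
    rw [ContinuousAlternatingMap.alternatizeUncurryFin_smul, ContinuousAlternatingMap.smul_apply,
      h, AlternatingMap.smul_apply]

variable [MeasurableSpace V] [BorelSpace V]

theorem busemannDensity_nonneg (v : Fin 2 → V) : 0 ≤ busemannDensity v := by
  by_cases hv : LinearIndependent ℝ v
  · rw [busemannDensity_eq hv]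
    have := radialArea_pos (v := v 0) (w := v 1) (by rwa [← eq_vecCons_fin_two v])
    positivity
  · rw [busemannDensity, if_neg hv]

theorem sum_abs_wedge_le {ι : Type*} [Fintype ι] (F : ι → StrongDual ℝ V) (v : Fin 2 → V) :
    ∑ i, ∑ j, |wedge (F i) (F j) v| ≤ 2 * (∑ i, ‖F i‖) ^ 2 / Real.pi * busemannDensity v := by
  by_cases hv : LinearIndependent ℝ v
  · have hv' : LinearIndependent ℝ ![v 0, v 1] := by rwa [← eq_vecCons_fin_two v]
    have hA := radialArea_pos hv'
    rw [busemannDensity_eq hv, div_mul_div_cancel₀ Real.pi_pos.ne', le_div_iff₀ hA]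
    refine le_trans (le_of_eq ?_) (sum_abs_wedge_mul_radialArea_le hv' F)
    simp only [wedge_apply, mul_comm (F _ (v 1))]
  · have h0 : ∀ i j, wedge (F i) (F j) v = 0 := fun i j =>
      AlternatingMap.map_linearDependent _ v hv
    rw [busemannDensity, if_neg hv]
    simp [h0]

/-- Each pair of vectors is almost calibrated by a `2`-form of finite rank. -/
theorem exists_calibration (v : Fin 2 → V) {ε : ℝ} (hε : 0 < ε) :
    ∃ Ω ∈ finiteRankForms V, (∀ u, |Ω u| ≤ busemannDensity u) ∧ busemannDensity v - ε ≤ Ω v := by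
  by_cases hv : LinearIndependent ℝ v
  swap
  · refine ⟨0, zero_mem _, fun u => by simpa using busemannDensity_nonneg u, ?_⟩
    rw [busemannDensity, if_neg hv]
    simpa using hε.le
  have hv' : LinearIndependent ℝ ![v 0, v 1] := by rwa [← eq_vecCons_fin_two v]
  have hA := radialArea_pos hv'
  have hμ : 0 < busemannDensity v := by
    rw [busemannDensity_eq hv]
    exact div_pos Real.pi_pos hA
  -- This defect in the constant becomes exactly `ε` after multiplication by `π / (2 * W ^ 2)`.
  obtain ⟨n, F, hW, hF⟩ := exists_lt_sum_abs_wedge_mul_radialArea hv'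
    (c := 2 - 2 * ε / busemannDensity v) (by have := div_pos (mul_pos two_pos hε) hμ; linarith)
  set W := ∑ i, ‖F i‖
  -- The signs are frozen at `v`: the form attains the sum of absolute values there and is bounded
  -- by it at every other pair.
  set s : Fin n → Fin n → ℝ := fun i j => SignType.sign (wedge (F i) (F j) v) with hs
  have hs1 : ∀ i j, |s i j| ≤ 1 := fun i j => by
    rcases lt_trichotomy (wedge (F i) (F j) v) 0 with h | h | h <;> simp [hs, h]
  refine ⟨(Real.pi / (2 * W ^ 2)) • ∑ i, ∑ j, s i j • wedge (F i) (F j), ?_, fun u => ?_, ?_⟩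
  · exact Submodule.smul_mem _ _ (Submodule.sum_mem _ fun i _ => Submodule.sum_mem _ fun j _ =>
      Submodule.smul_mem _ _ (wedge_mem_finiteRankForms _ _))
  · have h1 : |∑ i, ∑ j, s i j * wedge (F i) (F j) u| ≤ ∑ i, ∑ j, |wedge (F i) (F j) u| := by
      refine (Finset.abs_sum_le_sum_abs _ _).trans (Finset.sum_le_sum fun i _ => ?_)
      refine (Finset.abs_sum_le_sum_abs _ _).trans (Finset.sum_le_sum fun j _ => ?_)
      rw [abs_mul]
      exact mul_le_of_le_one_left (abs_nonneg _) (hs1 i j)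
    have h2 := h1.trans (sum_abs_wedge_le F u)
    simp only [AlternatingMap.smul_apply, alternatingMap_sum_apply, smul_eq_mul]
    rw [abs_mul, abs_of_pos (div_pos Real.pi_pos (by positivity : 0 < 2 * W ^ 2))]
    refine (mul_le_mul_of_nonneg_left h2 (by positivity)).trans (le_of_eq ?_)
    have := Real.pi_pos.ne'
    change Real.pi / (2 * W ^ 2) * (2 * W ^ 2 / Real.pi * busemannDensity u) = _
    field_simp
  · simp only [AlternatingMap.smul_apply, alternatingMap_sum_apply, smul_eq_mul]
    have h1 : ∀ i j, s i j * wedge (F i) (F j) v =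
        |F i (v 0) * F j (v 1) - F i (v 1) * F j (v 0)| := fun i j => by
      rw [hs, sign_mul_self, wedge_apply]
    simp only [h1]
    rw [← div_le_iff₀ hA] at hF
    refine le_trans (le_of_eq ?_) (mul_le_mul_of_nonneg_left hF
      (div_nonneg Real.pi_pos.le (by positivity : 0 ≤ 2 * W ^ 2)))
    have h3 := busemannDensity_eq hv
    have h4 := Real.pi_pos.ne'
    have h5 : Real.pi / (2 * W ^ 2) * ((2 - 2 * ε / busemannDensity v) * W ^ 2 /
        radialArea (v 0) (v 1)) =
        Real.pi / radialArea (v 0) (v 1) * (1 - ε / busemannDensity v) := by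
      field_simp
    rw [h5, ← h3]
    field_simp

/-- The case of two functionals. It makes a small positive multiple of each `F ∧ G` admissible in
the supremum, which is what definiteness of the norm needs. -/
theorem abs_wedge_le (F G : StrongDual ℝ V) (v : Fin 2 → V) :
    |wedge F G v| ≤ (‖F‖ + ‖G‖) ^ 2 / Real.pi * busemannDensity v := by
  have h := sum_abs_wedge_le ![F, G] v
  have h1 : |wedge G F v| = |wedge F G v| := by
    rw [wedge_apply, wedge_apply, ← abs_neg]
    congr 1; ring
  have h2 : ∀ H : StrongDual ℝ V, wedge H H v = 0 := fun H => by
    rw [wedge_apply]; ring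
  simp only [Fin.sum_univ_two, Matrix.cons_val_zero, Matrix.cons_val_one, h1, h2, abs_zero] at h
  rw [mul_div_assoc, mul_assoc] at h
  linarith

end

/-! ### Extension of the density to a norm on the exterior power. -/

section

variable {V : Type*} [AddCommGroup V] [Module ℝ V]

/-- A density is extendibly convex if it is the supremum of the linear functions on the exterior
power that it dominates, and if these separate points. -/
theorem isExtendiblyConvex_of_calibrations {k : ℕ} {μ : (Fin k → V) → ℝ}
    (h₁ : ∀ v, ∀ ε > 0, ∃ φ : ⋀[ℝ]^k V →ₗ[ℝ] ℝ, (∀ u, |φ (exteriorPower.ιMulti ℝ k u)| ≤ μ u) ∧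
      μ v - ε ≤ φ (exteriorPower.ιMulti ℝ k v))
    (h₂ : ∀ a : ⋀[ℝ]^k V, a ≠ 0 → ∃ φ : ⋀[ℝ]^k V →ₗ[ℝ] ℝ,
      (∀ u, |φ (exteriorPower.ιMulti ℝ k u)| ≤ μ u) ∧ φ a ≠ 0) :
    IsExtendiblyConvex μ := by
  set C : Set (⋀[ℝ]^k V →ₗ[ℝ] ℝ) := {φ | ∀ u, |φ (exteriorPower.ιMulti ℝ k u)| ≤ μ u} with hC
  have hne : Nonempty C := by
    obtain ⟨φ, hφ, -⟩ := h₁ 0 1 one_pos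
    exact ⟨⟨φ, hφ⟩⟩
  have hbdd : ∀ a, BddAbove (Set.range fun φ : C => |φ.1 a|) := by
    intro a
    -- The density bounds all of `C` on simple vectors, and these span.
    suffices h : ∃ M, ∀ φ ∈ C, |φ a| ≤ M by
      obtain ⟨M, hM⟩ := h
      exact ⟨M, by rintro _ ⟨φ, rfl⟩; exact hM φ.1 φ.2⟩
    have ha : a ∈ Submodule.span ℝ (Set.range (exteriorPower.ιMulti ℝ k (M := V))) := by
      rw [exteriorPower.ιMulti_span]; trivial
    induction ha using Submodule.span_induction with
    | mem a h =>
      obtain ⟨u, rfl⟩ := h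
      exact ⟨μ u, fun φ hφ => hφ u⟩
    | zero => exact ⟨0, fun φ _ => by simp⟩
    | add a b _ _ h₁ h₂ =>
      obtain ⟨M₁, h₁⟩ := h₁
      obtain ⟨M₂, h₂⟩ := h₂
      refine ⟨M₁ + M₂, fun φ hφ => ?_⟩
      rw [map_add]
      exact (abs_add_le _ _).trans (add_le_add (h₁ φ hφ) (h₂ φ hφ))
    | smul c a _ h =>
      obtain ⟨M, h⟩ := h
      refine ⟨|c| * M, fun φ hφ => ?_⟩
      rw [map_smul, smul_eq_mul, abs_mul]
      exact mul_le_mul_of_nonneg_left (h φ hφ) (abs_nonneg _)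
  refine ⟨Seminorm.of (fun a => ⨆ φ : C, |φ.1 a|) (fun a b => ?_) (fun c a => ?_),
    fun a ha => ?_, fun v => ?_⟩
  · refine ciSup_le fun φ => ?_
    rw [map_add]
    exact (abs_add_le _ _).trans (add_le_add (le_ciSup (hbdd a) φ) (le_ciSup (hbdd b) φ))
  · simp only [map_smul, smul_eq_mul, abs_mul, Real.norm_eq_abs]
    exact (Real.mul_iSup_of_nonneg (abs_nonneg c) _).symm
  · by_contra hne0
    obtain ⟨φ, hφ, hφa⟩ := h₂ a hne0
    have h := le_ciSup (hbdd a) ⟨φ, hφ⟩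
    change (⨆ φ : C, |φ.1 a|) = 0 at ha
    rw [ha] at h
    exact hφa (abs_nonpos_iff.1 h)
  · change (⨆ φ : C, |φ.1 (exteriorPower.ιMulti ℝ k v)|) = μ v
    refine le_antisymm (ciSup_le fun φ => φ.2 v) (le_of_forall_sub_le fun ε hε => ?_)
    obtain ⟨φ, hφ, hφv⟩ := h₁ v ε hε
    exact hφv.trans ((le_abs_self _).trans (le_ciSup (hbdd _) ⟨φ, hφ⟩))

/-- An element of the exterior power is fixed by the maps that fix a suitable subspace of finite
dimension. -/
theorem exists_finiteDimensional_map_eq_self {k : ℕ} (a : ⋀[ℝ]^k V) :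
    ∃ W : Submodule ℝ V, FiniteDimensional ℝ W ∧
      ∀ P : V →ₗ[ℝ] V, (∀ x ∈ W, P x = x) → exteriorPower.map k P a = a := by
  have ha : a ∈ Submodule.span ℝ (Set.range (exteriorPower.ιMulti ℝ k (M := V))) := by
    rw [exteriorPower.ιMulti_span]; trivial
  induction ha using Submodule.span_induction with
  | mem a h =>
    obtain ⟨u, rfl⟩ := h
    refine ⟨Submodule.span ℝ (Set.range u), FiniteDimensional.span_of_finite ℝ
      (Set.finite_range u), fun P hP => ?_⟩
    rw [exteriorPower.map_apply_ιMulti]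
    congr 1
    funext i
    exact hP _ (Submodule.subset_span (Set.mem_range_self i))
  | zero => exact ⟨⊥, inferInstance, fun P _ => map_zero _⟩
  | add a b _ _ h₁ h₂ =>
    obtain ⟨W₁, _, h₁⟩ := h₁
    obtain ⟨W₂, _, h₂⟩ := h₂
    refine ⟨W₁ ⊔ W₂, inferInstance, fun P hP => ?_⟩
    rw [map_add, h₁ P fun x hx => hP x (Submodule.mem_sup_left hx),
      h₂ P fun x hx => hP x (Submodule.mem_sup_right hx)]
  | smul c a _ h =>
    obtain ⟨W, hW, h⟩ := h
    exact ⟨W, hW, fun P hP => by rw [map_smul, h P hP]⟩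

end

section

variable {V : Type*} [NormedAddCommGroup V] [NormedSpace ℝ V]

/-- The pullback of a `2`-form under a map of finite rank is a form of finite rank. -/
theorem compLinearMap_mem_finiteRankForms (Ω : V [⋀^Fin 2]→ₗ[ℝ] ℝ) {ι : Type*} [Fintype ι]
    (F : ι → StrongDual ℝ V) (b : ι → V) {P : V →ₗ[ℝ] V} (hP : ∀ x, P x = ∑ i, F i x • b i) :
    Ω.compLinearMap P ∈ finiteRankForms V := by
  classical
  have hexp : ∀ u : Fin 2 → V, Ω (fun i => P (u i)) =
      ∑ r : Fin 2 → ι, F (r 0) (u 0) * F (r 1) (u 1) * Ω fun i => b (r i) := by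
    intro u
    simp only [hP]
    have h := Ω.toMultilinearMap.map_sum (fun i j => F j (u i) • b j)
    refine h.trans (Finset.sum_congr rfl fun r _ => ?_)
    have h' := Ω.toMultilinearMap.map_smul_univ (fun i => F (r i) (u i)) (fun i => b (r i))
    rw [h', Fin.prod_univ_two, smul_eq_mul]
    rfl
  -- The sum runs over ordered pairs of indices and each wedge antisymmetrizes its pair, hence the
  -- factor one half.
  have key : Ω.compLinearMap P =
      (2⁻¹ : ℝ) • ∑ r : Fin 2 → ι, (Ω fun i => b (r i)) • wedge (F (r 0)) (F (r 1)) := by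
    ext u
    have h1 := hexp u
    have h2 := hexp (u ∘ Equiv.swap 0 1)
    have h3 : Ω (fun i => P ((u ∘ Equiv.swap 0 1) i)) = -Ω fun i => P (u i) :=
      Ω.map_swap (fun i => P (u i)) (by decide : (0 : Fin 2) ≠ 1)
    rw [h3] at h2
    simp only [Function.comp_apply, Equiv.swap_apply_left, Equiv.swap_apply_right] at h2
    simp only [AlternatingMap.smul_apply, alternatingMap_sum_apply, smul_eq_mul,
      AlternatingMap.compLinearMap_apply, wedge_apply, mul_sub, Finset.sum_sub_distrib]
    simp only [mul_comm (Ω _)]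
    change Ω (fun i => P (u i)) = _
    linarith
  rw [key]
  exact Submodule.smul_mem _ _ (Submodule.sum_mem _ fun r _ =>
    Submodule.smul_mem _ _ (wedge_mem_finiteRankForms _ _))

/-- The exterior products of continuous linear functions separate the points of the exterior
square. -/
theorem exists_wedge_ne_zero {a : ⋀[ℝ]^2 V} (ha : a ≠ 0) : ∃ F G : StrongDual ℝ V,
    exteriorPower.alternatingMapLinearEquiv (wedge F G) a ≠ 0 := by
  by_contra! h
  have hfin : ∀ Ω ∈ finiteRankForms V, exteriorPower.alternatingMapLinearEquiv Ω a = 0 := by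
    intro Ω hΩ
    induction hΩ using Submodule.span_induction with
    | mem Ω hΩ =>
      obtain ⟨p, rfl⟩ := hΩ
      exact h _ _
    | zero => simp
    | add Ω₁ Ω₂ _ _ h₁ h₂ => rw [map_add, LinearMap.add_apply, h₁, h₂, add_zero]
    | smul c Ω _ h => rw [map_smul, LinearMap.smul_apply, h, smul_zero]
  obtain ⟨W, hW, hfix⟩ := exists_finiteDimensional_map_eq_self a
  -- Composing with a continuous projection onto `W` does not change the pairing with `a` and turns
  -- an arbitrary functional into a form of finite rank; so if all wedges kill `a`, every functional
  -- does.
  obtain ⟨p, hp⟩ := Submodule.ClosedComplemented.of_finiteDimensional (𝕜 := ℝ) W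
  set b := finBasis ℝ W
  set P : V →ₗ[ℝ] V := W.subtype ∘ₗ p.toLinearMap
  have hP : ∀ x, P x = ∑ i, ((b.coord i).toContinuousLinearMap.comp p) x • (b i : V) := by
    intro x
    have := congrArg W.subtype (b.sum_repr (p x))
    rw [map_sum] at this
    exact this.symm
  refine ha ((forall_dual_apply_eq_zero_iff ℝ a).1 fun φ => ?_)
  have h1 := hfin _ (compLinearMap_mem_finiteRankForms
    (exteriorPower.alternatingMapLinearEquiv.symm φ) _ _ hP)
  have h2 : exteriorPower.alternatingMapLinearEquiv
      ((exteriorPower.alternatingMapLinearEquiv.symm φ).compLinearMap P) =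
      φ ∘ₗ exteriorPower.map 2 P := by
    ext u
    simp [Function.comp_def]
  rw [h2, LinearMap.comp_apply, hfix P fun x hx => congrArg Subtype.val (hp ⟨x, hx⟩)] at h1
  exact h1

theorem isExtendiblyConvex_busemannDensity [MeasurableSpace V] [BorelSpace V] :
    IsExtendiblyConvex (busemannDensity : (Fin 2 → V) → ℝ) := by
  refine isExtendiblyConvex_of_calibrations (fun v ε hε => ?_) fun a ha => ?_
  · obtain ⟨Ω, -, hΩ, hv⟩ := exists_calibration v hε
    refine ⟨exteriorPower.alternatingMapLinearEquiv Ω, fun u => ?_, ?_⟩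
    · rw [exteriorPower.alternatingMapLinearEquiv_apply_ιMulti]
      exact hΩ u
    · rwa [exteriorPower.alternatingMapLinearEquiv_apply_ιMulti]
  · obtain ⟨F, G, hFG⟩ := exists_wedge_ne_zero ha
    set c := (‖F‖ + ‖G‖) ^ 2 / Real.pi with hc
    have hc0 : 0 ≤ c := by positivity
    have hc1 : 0 < (1 + c)⁻¹ := by positivity
    refine ⟨(1 + c)⁻¹ • exteriorPower.alternatingMapLinearEquiv (wedge F G), fun u => ?_, ?_⟩
    · rw [LinearMap.smul_apply, exteriorPower.alternatingMapLinearEquiv_apply_ιMulti, smul_eq_mul,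
        abs_mul, abs_of_pos hc1, inv_mul_le_iff₀ (by positivity)]
      refine (abs_wedge_le F G u).trans ?_
      exact mul_le_mul_of_nonneg_right (by linarith) (busemannDensity_nonneg u)
    · exact smul_ne_zero hc1.ne' hFG

/-! ### Calibrations imply minimality. -/

/-- A density that is, up to arbitrarily small errors, calibrated by forms of finite rank is
semi-elliptic. -/
theorem isSemiElliptic_of_calibrations {μ : (Fin 2 → V) → ℝ}
    (h : ∀ v, ∀ ε > 0, ∃ Ω ∈ finiteRankForms V, (∀ u, |Ω u| ≤ μ u) ∧ μ v - ε ≤ Ω v) :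
    IsSemiElliptic 1 μ := by
  intro p A _ K hK hKb S hS
  set v : Fin 2 → V := fun i => A (Pi.single i 1) with hv
  have hpart : ∀ x, partials (fun x => p + A x) x = v := by
    intro x
    funext i
    have hd : HasFDerivAt (fun x => p + A x) A.toContinuousLinearMap x :=
      A.toContinuousLinearMap.hasFDerivAt.const_add p
    rw [partials, hd.fderiv]
    rfl
  have hKfin : volume K ≠ ⊤ := hKb.measure_lt_top.ne
  have harea : pieceArea μ K (fun x => p + A x) = ENNReal.ofReal (μ v) * volume K := by
    simp only [pieceArea, hpart, setLIntegral_const]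
  have hle : ∀ ε > 0, ENNReal.ofReal (μ v - ε) * volume K ≤ chainArea μ S := by
    intro ε hε
    obtain ⟨Ω, hΩ, hΩμ, hΩv⟩ := h v ε hε
    -- Since `Ω` is `dη` with `η` linear, the boundary hypothesis equates its integrals over the
    -- chain and over the flat region.
    obtain ⟨η, hη⟩ := exists_alternatizeUncurryFin_eq hΩ
    have hext : ∀ x u, extDeriv η x u = Ω u := fun x u => by
      rw [extDeriv, ContinuousLinearMap.fderiv, hη]
    have hb := hS η η.contDiff
    have hright : pieceIntegral K (fun x => p + A x) (extDeriv η) = volume.real K * Ω v := by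
      simp only [pieceIntegral, hext, hpart, setIntegral_const, smul_eq_mul]
    rw [hright] at hb
    -- The bound on `Ω` holds for every pair of vectors, hence pointwise under the integral, whether
    -- or not `σ` is differentiable there.
    have hpiece : ∀ σ : LipschitzSimplex 2 V,
        ENNReal.ofReal |pieceIntegral (cornerSimplex 2) σ.toFun (extDeriv η)| ≤
          pieceArea μ (cornerSimplex 2) σ.toFun := by
      intro σ
      simp only [pieceIntegral, hext]
      rw [← Real.norm_eq_abs, ofReal_norm]
      refine (enorm_integral_le_lintegral_enorm _).trans (lintegral_mono fun x => ?_)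
      rw [← ofReal_norm]
      exact ENNReal.ofReal_le_ofReal (hΩμ _)
    calc ENNReal.ofReal (μ v - ε) * volume K ≤ ENNReal.ofReal (Ω v) * volume K := by gcongr
      _ = ENNReal.ofReal (chainIntegral S (extDeriv η)) := by
        rw [hb, ENNReal.ofReal_mul measureReal_nonneg, measureReal_def,
          ENNReal.ofReal_toReal hKfin, mul_comm]
      _ ≤ ENNReal.ofReal (∑ σ ∈ S.support,
          |S σ| * |pieceIntegral (cornerSimplex 2) σ.toFun (extDeriv η)|) := by
        refine ENNReal.ofReal_le_ofReal (Finset.sum_le_sum fun σ _ => ?_)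
        rw [← abs_mul]
        exact le_abs_self _
      _ = ∑ σ ∈ S.support, ENNReal.ofReal |S σ| *
          ENNReal.ofReal |pieceIntegral (cornerSimplex 2) σ.toFun (extDeriv η)| := by
        rw [ENNReal.ofReal_sum_of_nonneg fun σ _ =>
          mul_nonneg (abs_nonneg _) (abs_nonneg _)]
        exact Finset.sum_congr rfl fun σ _ => ENNReal.ofReal_mul (abs_nonneg _)
      _ ≤ chainArea μ S := Finset.sum_le_sum fun σ _ => mul_le_mul_right (hpiece σ) _
  rw [harea]
  have hlim : Filter.Tendsto (fun ε : ℝ => ENNReal.ofReal (μ v - ε) * volume K)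
      (nhdsWithin 0 (Set.Ioi 0)) (nhds (ENNReal.ofReal (μ v - 0) * volume K)) := by
    refine ENNReal.Tendsto.mul_const (ENNReal.tendsto_ofReal ?_) (Or.inr hKfin)
    exact ((continuous_const.sub continuous_id).tendsto (0 : ℝ)).mono_left nhdsWithin_le_nhds
  rw [sub_zero] at hlim
  exact le_of_tendsto hlim (Filter.eventually_of_mem self_mem_nhdsWithin fun ε hε => hle ε hε)

end

theorem mainTheorem3 (V : Type*) [NormedAddCommGroup V] [NormedSpace ℝ V] [MeasurableSpace V]
    [BorelSpace V] :
    IsExtendiblyConvex (busemannDensity : (Fin 2 → V) → ℝ) ∧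
      (FiniteDimensional ℝ V → IsSemiElliptic 1 (busemannDensity : (Fin 2 → V) → ℝ)) := by
  exact ⟨isExtendiblyConvex_busemannDensity, fun _ =>
    isSemiElliptic_of_calibrations fun v _ hε => exists_calibration v hε⟩
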